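/- Let $d\ge 1$, let $T\subseteq\mathbb R^d$ be a Lebesgue measurable set with $0\in T$, and let $\int_T\cdot\,dt$ denote the Lebesgue integral over $T$ if $T$ is uncountable and the sum over $t\in T$ if $T$ is countable. Let $(\Omega,\mathcal F,P)$ be a probability space and let $X_t=G(Y_t)Z_t$, $t\in T$, where $Y=\{Y_t\}_{t\in T}$ and $Z=\{Z_t\}_{t\in T}$ are independent (strictly) stationary real random fields, $G:\mathbb R\to\mathbb R$ is a measurable function with either $G\ge 0$ everywhere or $G\le 0$ everywhere, $P(G(Y_t)=0)=0$ for all $t\in T$, and the covariances $\mathrm{Cov}(\mathbf 1(Z_0>u),\mathbf 1(Z_t>v))$ are either $\ge 0$ for all $t\in T\setminus\{0\}$, $u,v\in\mathbb R$, or $\le 0$ for all such $t,u,v$. Assume that $Y$ is a centered Gaussian random field with unit variance whose covariance function $\rho(t)=\mathrm{Cov}(Y_0,Y_t)$, $t\in T$, is measurable, satisfies $\rho(t)\ge 0$ for all $t\in T$, and satisfies $|\rho(t)|<1$ for all $t\in T\setminus\{0\}$ if $T$ is countable, and for Lebesgue-almost every $t\in T$ if $T$ is uncountable. Let $\bar F_Z(x)=1-P(Z_0\le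 x)$, let $\varphi$ be the standard normal density, $\langle f,g\rangle_\varphi=\int_{\mathbb R}f(x)g(x)\varphi(x)\,dx$, and let $H_k(x)=(-1)^k\varphi(x)^{-1}\varphi^{(k)}(x)$ be the Hermite polynomials. For a finite Borel measure $\mu$ on $\mathbb R$ put $$D_\mu(G(Y),Z_0)=\int_T\left(\int_{\mathbb R^2}\mathrm{Cov}\big(\bar F_Z(u/G(Y_0)),\,\bar F_Z(v/G(Y_t))\big)\,\mu(du)\,\mu(dv)\right)dt .$$ Then, for every finite Borel measure $\mu$ on $\mathbb R$, the integral over $T$ is well defined in $[0,\infty]$, and $$D_\mu(G(Y),Z_0)=\sum_{k=1}^\infty\frac{\Big(\int_{\mathbb R}\big\langle\bar F_Z(u/G(\cdot)),H_k\big\rangle_\varphi\,\mu(du)\Big)^2}{k!}\int_T\rho(t)^k\,dt$$ as an equality in $[0,\infty]$, with the convention $0\cdot\infty=0$. -/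

import Mathlib

open MeasureTheory ProbabilityTheory
open scoped ENNReal

noncomputable section

namespace RandVol

/-- The index space `ℝ^d`. -/
abbrev Idx (d : ℕ) := EuclideanSpace ℝ (Fin d)

open Classical in
/-- The measure `dt` on the index set `T ⊆ ℝ^d`: counting measure if `T` is countable (integrals over
`T` are then sums), and `d`-dimensional Lebesgue measure on `T` otherwise. -/
def indexMeasure {d : ℕ} (T : Set (Idx d)) : Measure T :=
  if T.Countable then Measure.count else Measure.comap Subtype.val (volume : Measure (Idx d))

/-- The Lebesgue integral of a real function with values in `[-∞, ∞]`, i.e. the integral of the positive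
part minus that of the negative part. In the undefined case `∞ - ∞` the value is `-∞`. -/
def extIntegral {α : Type*} [MeasurableSpace α] (m : Measure α) (f : α → ℝ) : EReal :=
  ((∫⁻ t, ENNReal.ofReal (f t) ∂m : ℝ≥0∞) : EReal) - ((∫⁻ t, ENNReal.ofReal (-f t) ∂m : ℝ≥0∞) : EReal)

/-- Tail distribution function `x ↦ 1 - P(ζ ≤ x)` of a random variable `ζ`. -/
def tail {Ω : Type*} [MeasurableSpace Ω] (P : Measure Ω) (ζ : Ω → ℝ) (x : ℝ) : ℝ :=
  1 - P.real {ω | ζ ω ≤ x}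

/-- `⟨f, g⟩_φ = ∫ f(x) g(x) φ(x) dx`, where `φ` is the standard normal density. -/
def innerPhi (f g : ℝ → ℝ) : ℝ := ∫ x, f x * g x * gaussianPDFReal 0 1 x

/-- The (probabilists') Hermite polynomial `H_k` as a real function. -/
def hermiteFun (k : ℕ) (x : ℝ) : ℝ := Polynomial.aeval x (Polynomial.hermite k)

/-- Strict stationarity of a random field on `T ⊆ ℝ^d`: finite-dimensional distributions do not change
under those translations that keep the points inside `T`. -/
def IsStationary {d : ℕ} {T : Set (Idx d)} {Ω : Type*} [MeasurableSpace Ω] (P : Measure Ω)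
    (X : T → Ω → ℝ) : Prop :=
  ∀ (n : ℕ) (t s : Fin n → T) (h : Idx d), (∀ i, (s i : Idx d) = t i + h) →
    P.map (fun ω i => X (s i) ω) = P.map (fun ω i => X (t i) ω)

/-- `Cov(1(X_0 > u), 1(X_t > v))`. -/
def covInd {d : ℕ} {T : Set (Idx d)} (h0 : 0 ∈ T) {Ω : Type*} [MeasurableSpace Ω] (P : Measure Ω)
    (X : T → Ω → ℝ) (t : T) (u v : ℝ) : ℝ :=
  cov[{ω | u < X ⟨0, h0⟩ ω}.indicator (fun _ => (1 : ℝ)),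
    {ω | v < X t ω}.indicator (fun _ => (1 : ℝ)); P]

/-- The indicator covariances of `X` have a constant sign. The lag `t = 0` is not constrained: there the
covariance is always nonnegative, and negatively associated fields are meant to be covered. -/
def ConstSignCov {d : ℕ} {T : Set (Idx d)} (h0 : 0 ∈ T) {Ω : Type*} [MeasurableSpace Ω]
    (P : Measure Ω) (X : T → Ω → ℝ) : Prop :=
  (∀ t : T, (t : Idx d) ≠ 0 → ∀ u v, 0 ≤ covInd h0 P X t u v) ∨
  (∀ t : T, (t : Idx d) ≠ 0 → ∀ u v, covInd h0 P X t u v ≤ 0)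

/-- The random volatility model `X_t = G(Y_t) Z_t`. -/
structure IsRandomVolatility {d : ℕ} {T : Set (Idx d)} (h0 : 0 ∈ T) {Ω : Type*} [MeasurableSpace Ω]
    (P : Measure Ω) (G : ℝ → ℝ) (Y Z X : T → Ω → ℝ) : Prop where
  eq_mul : ∀ t ω, X t ω = G (Y t ω) * Z t ω
  measurable_Y : ∀ t, Measurable (Y t)
  measurable_Z : ∀ t, Measurable (Z t)
  measurable_G : Measurable G
  indep : IndepFun (fun ω t => Y t ω) (fun ω t => Z t ω) P
  stationary_Y : IsStationary P Y
  stationary_Z : IsStationary P Z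
  constSign_Z : ConstSignCov h0 P Z
  sign_G : (∀ x, 0 ≤ G x) ∨ (∀ x, G x ≤ 0)
  ne_zero : ∀ t, P {ω | G (Y t ω) = 0} = 0

/-- The covariance function `ρ(t) = Cov(Y_0, Y_t)`. -/
def covFun {d : ℕ} {T : Set (Idx d)} (h0 : 0 ∈ T) {Ω : Type*} [MeasurableSpace Ω] (P : Measure Ω)
    (Y : T → Ω → ℝ) (t : T) : ℝ :=
  cov[Y ⟨0, h0⟩, Y t; P]

/-- `|ρ(t)| < 1` for all `t ≠ 0` if `T` is countable, for almost every `t ∈ T` if `T` is uncountable. -/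
def CondRho {d : ℕ} (T : Set (Idx d)) (ρ : T → ℝ) : Prop :=
  (T.Countable → ∀ t : T, (t : Idx d) ≠ 0 → |ρ t| < 1) ∧
  (¬ T.Countable → ∀ᵐ t ∂(indexMeasure T), |ρ t| < 1)

/-- The functional
`D_μ(A, ζ) = ∫_T ∫_{ℝ²} Cov(F̄_ζ(u / A_0), F̄_ζ(v / A_t)) μ(du) μ(dv) dt ∈ [-∞, ∞]`. -/
def D {d : ℕ} {T : Set (Idx d)} (h0 : 0 ∈ T) {Ω : Type*} [MeasurableSpace Ω] (P : Measure Ω)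
    (μ : Measure ℝ) (A : T → Ω → ℝ) (ζ : Ω → ℝ) : EReal :=
  extIntegral (indexMeasure T) fun t =>
    ∫ p : ℝ × ℝ, cov[fun ω => tail P ζ (p.1 / A ⟨0, h0⟩ ω), fun ω => tail P ζ (p.2 / A t ω); P]
      ∂(μ.prod μ)

end RandVol

end

/-! Write `g u y` for the tail of `Z 0` at `u / G y` and `f y = ∫ u, g u y ∂μ`, a bounded function.
By Fubini, the inner double integral is `Cov(f(Y_0), f(Y_t))` (`integral_covariance_comp`). Since
`(Y_0, Y_t)` is a standard Gaussian pair with correlation `ρ(t)`, Mehler's expansion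
(`hasSum_covariance_comp`) turns this covariance into `∑_{k ≥ 1} ⟨f, H_k⟩² ρ(t)^k / k!`. As `ρ ≥ 0`,
every term is nonnegative: the integral over `T` is well defined and may be taken term by term.

Mehler's expansion rests on two facts: the normalised Hermite polynomials form a Hilbert basis of
`L²` of the standard Gaussian (`hermiteBasis`), and averaging `H_k(V)` given `U` yields `r^k H_k(U)`
(`integral_hermiteReal_add_gaussianReal`). -/

noncomputable section

namespace RandVol

open Polynomial
open scoped NNReal Nat

/-! ### Gaussian integration by parts and Hermite identities. -/

section GaussianPolynomials

theorem integrable_polynomial_gaussianReal (v : ℝ≥0) (p : ℝ[X]) :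
    Integrable (fun x => p.eval x) (gaussianReal 0 v) := by
  induction p using Polynomial.induction_on' with
  | add p q hp hq => exact (hp.add hq).congr (ae_of_all _ fun x => by simp)
  | monomial n a =>
    have h : Integrable (fun x : ℝ => id x ^ n) (gaussianReal 0 v) :=
      integrable_pow_of_mem_interior_integrableExpSet
        (by rw [integrableExpSet_id_gaussianReal]; simp) n
    exact (h.const_mul a).congr (ae_of_all _ fun x => by simp)

theorem memLp_polynomial_gaussianReal (v : ℝ≥0) (p : ℝ[X]) :
    MemLp (fun x => p.eval x) 2 (gaussianReal 0 v) := by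
  rw [memLp_two_iff_integrable_sq (by fun_prop)]
  exact (integrable_polynomial_gaussianReal v (p ^ 2)).congr (ae_of_all _ fun x => by simp)

theorem hasDerivAt_gaussianPDFReal {v : ℝ≥0} (x : ℝ) :
    HasDerivAt (gaussianPDFReal 0 v) (-(x / v) * gaussianPDFReal 0 v x) x := by
  rw [gaussianPDFReal_def]
  have h := (((((hasDerivAt_id x).sub_const 0).pow 2).neg.div_const (2 * (v : ℝ))).exp).const_mul
    (√(2 * Real.pi * v))⁻¹
  refine h.congr_deriv ?_
  by_cases hv : (v : ℝ) = 0
  · simp [hv]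
  · simp
    field_simp

theorem integrable_smul_gaussianPDFReal_iff {v : ℝ≥0} (hv : v ≠ 0) {f : ℝ → ℝ} :
    Integrable (fun x => f x * gaussianPDFReal 0 v x) ↔ Integrable f (gaussianReal 0 v) := by
  rw [gaussianReal_of_var_ne_zero 0 hv,
    integrable_withDensity_iff (measurable_gaussianPDF 0 v) (by simp [gaussianPDF])]
  simp [toReal_gaussianPDF]

/-- Gaussian integration by parts for polynomials. -/
theorem integral_mul_polynomial_gaussianReal (v : ℝ≥0) (p : ℝ[X]) :
    ∫ x, x * p.eval x ∂(gaussianReal 0 v) = v * ∫ x, p.derivative.eval x ∂(gaussianReal 0 v) := by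
  -- Variance zero is the Dirac mass at `0`. It must be covered because the residual variance `1 - r
  -- ^ 2` vanishes when `|r| = 1`, in particular at lag `0`.
  by_cases hv : v = 0
  · simp [hv]
  have hv' : (v : ℝ) ≠ 0 := by exact_mod_cast hv
  have key : ∀ q : ℝ[X], Integrable (fun x => q.eval x * gaussianPDFReal 0 v x) := fun q =>
    (integrable_smul_gaussianPDFReal_iff hv).2 (integrable_polynomial_gaussianReal v q)
  have h := integral_eq_zero_of_hasDerivAt_of_integrable
    (f := fun x => p.eval x * gaussianPDFReal 0 v x)
    (fun x => (p.hasDerivAt x).mul (hasDerivAt_gaussianPDFReal x))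
    (by
      refine (key (p.derivative - C (v : ℝ)⁻¹ * X * p)).congr (ae_of_all _ fun x => ?_)
      simp
      ring) (key p)
  have h1 := integral_sub (key p.derivative) (key (C (v : ℝ)⁻¹ * X * p))
  have h2 : ∫ x, (p.derivative.eval x * gaussianPDFReal 0 v x
      - (C (v : ℝ)⁻¹ * X * p).eval x * gaussianPDFReal 0 v x) = 0 := by
    refine Eq.trans (integral_congr_ae (ae_of_all _ fun x => ?_)) h
    simp
    ring
  rw [h2, eq_comm, sub_eq_zero] at h1
  rw [integral_gaussianReal_eq_integral_smul hv, integral_gaussianReal_eq_integral_smul hv]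
  simp only [smul_eq_mul, mul_comm (gaussianPDFReal 0 v _)]
  rw [h1, ← integral_const_mul]
  congr with x
  simp
  field_simp

/-- The Hermite polynomials with real coefficients. -/
def hermiteReal (k : ℕ) : ℝ[X] := (hermite k).map (Int.castRingHom ℝ)

theorem hermiteFun_eq_eval (k : ℕ) (x : ℝ) : hermiteFun k x = (hermiteReal k).eval x := by
  simp [hermiteFun, hermiteReal, aeval_def, eval_map]

theorem hermiteReal_zero : hermiteReal 0 = 1 := by simp [hermiteReal]

theorem hermiteReal_succ (k : ℕ) :
    hermiteReal (k + 1) = X * hermiteReal k - derivative (hermiteReal k) := by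
  simp [hermiteReal, hermite_succ, derivative_map]

theorem derivative_hermiteReal_succ (k : ℕ) :
    derivative (hermiteReal (k + 1)) = C (k + 1 : ℝ) * hermiteReal k := by
  induction k with
  | zero => simp [hermiteReal_succ, hermiteReal_zero]
  | succ k ih =>
    rw [hermiteReal_succ (k + 1), derivative_sub, derivative_mul, ih, derivative_mul,
      hermiteReal_succ k]
    simp
    ring

/-- The operator `q ↦ X q - q'`, which raises `H_k` to `H_{k+1}`, is adjoint to differentiation:
integrating `X H_k p` by parts gives `(H_k p)'`, and the `H_k' p` terms cancel. Orthogonality and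
the norms `k!` follow by iteration. -/
theorem integral_hermiteReal_succ_mul (k : ℕ) (p : ℝ[X]) :
    ∫ x, (hermiteReal (k + 1) * p).eval x ∂(gaussianReal 0 1) =
      ∫ x, (hermiteReal k * derivative p).eval x ∂(gaussianReal 0 1) := by
  have h := integral_mul_polynomial_gaussianReal 1 (hermiteReal k * p)
  have h1 := integral_sub (integrable_polynomial_gaussianReal 1 (X * (hermiteReal k * p)))
    (integrable_polynomial_gaussianReal 1 (derivative (hermiteReal k) * p))
  have h2 := integral_sub (integrable_polynomial_gaussianReal 1 (derivative (hermiteReal k * p)))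
    (integrable_polynomial_gaussianReal 1 (derivative (hermiteReal k) * p))
  have e1 : ∀ x, (hermiteReal (k + 1) * p).eval x =
      (X * (hermiteReal k * p)).eval x - (derivative (hermiteReal k) * p).eval x := fun x => by
    rw [hermiteReal_succ, ← eval_sub]
    congr 1
    ring
  have e2 : ∀ x, (hermiteReal k * derivative p).eval x =
      (derivative (hermiteReal k * p)).eval x - (derivative (hermiteReal k) * p).eval x :=
    fun x => by
      rw [derivative_mul, ← eval_sub]
      congr 1
      ring
  simp_rw [e1, e2, h1, h2]
  simp only [NNReal.coe_one, one_mul] at h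
  rw [← h]
  simp

theorem integral_hermiteReal_mul_of_lt {j k : ℕ} (h : j < k) :
    ∫ x, (hermiteReal k * hermiteReal j).eval x ∂(gaussianReal 0 1) = 0 := by
  induction k generalizing j with
  | zero => omega
  | succ k ih =>
    rw [integral_hermiteReal_succ_mul]
    cases j with
    | zero => simp [hermiteReal_zero]
    | succ j =>
      have := ih (j := j) (by omega)
      simp only [eval_mul] at this
      simp only [derivative_hermiteReal_succ, eval_mul, eval_C, mul_left_comm _ ((j : ℝ) + 1)]
      rw [integral_const_mul, this, mul_zero]

theorem integral_hermiteReal_mul_self (k : ℕ) :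
    ∫ x, (hermiteReal k * hermiteReal k).eval x ∂(gaussianReal 0 1) = k ! := by
  induction k with
  | zero => simp [hermiteReal_zero]
  | succ k ih =>
    rw [integral_hermiteReal_succ_mul]
    simp only [eval_mul] at ih
    simp only [derivative_hermiteReal_succ, eval_mul, eval_C, mul_left_comm _ ((k : ℝ) + 1)]
    rw [integral_const_mul, ih, Nat.factorial_succ]
    push_cast
    ring

/-- Hermite polynomials are eigenfunctions of the Ornstein–Uhlenbeck semigroup. -/
theorem integral_hermiteReal_add_gaussianReal {r : ℝ} {v : ℝ≥0} (hv : (v : ℝ) = 1 - r ^ 2) (k : ℕ)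
    (x : ℝ) :
    ∫ w, (hermiteReal k).eval (r * x + w) ∂(gaussianReal 0 v) = r ^ k * (hermiteReal k).eval x := by
  -- `H_k' = k H_{k-1}` is an eigenfunction for `r ^ (k - 1)`; the extra factor `r` avoids the
  -- truncated exponent.
  have hder : ∀ k, ∀ x, (∀ m < k, ∀ x : ℝ, ∫ w, (hermiteReal m).eval (r * x + w) ∂(gaussianReal 0 v)
      = r ^ m * (hermiteReal m).eval x) →
      r * ∫ w, (derivative (hermiteReal k)).eval (r * x + w) ∂(gaussianReal 0 v) =
        r ^ k * (derivative (hermiteReal k)).eval x := by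
    intro k x ih
    cases k with
    | zero => simp [hermiteReal_zero]
    | succ k =>
      simp only [derivative_hermiteReal_succ, eval_mul, eval_C]
      rw [integral_const_mul, ih k (by omega)]
      ring
  induction k using Nat.strong_induction_on generalizing x with
  | _ k ih =>
  cases k with
  | zero => simp [hermiteReal_zero]
  | succ k =>
    have int : ∀ q : ℝ[X], Integrable (fun w => q.eval (r * x + w)) (gaussianReal 0 v) := fun q =>
      (integrable_polynomial_gaussianReal v (q.comp (C (r * x) + X))).congr
        (ae_of_all _ fun w => by simp)
    have hx := ih k (by omega) x
    have hd := hder k x fun m hm => ih m (by omega)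
    have hs := integral_mul_polynomial_gaussianReal v ((hermiteReal k).comp (C (r * x) + X))
    simp only [eval_comp, eval_add, eval_C, eval_X, derivative_comp, derivative_add, derivative_C,
      derivative_X, zero_add, one_mul] at hs
    have e : ∀ w, (hermiteReal (k + 1)).eval (r * x + w) =
        r * x * (hermiteReal k).eval (r * x + w) + w * (hermiteReal k).eval (r * x + w)
          - (derivative (hermiteReal k)).eval (r * x + w) := fun w => by
      rw [hermiteReal_succ]
      simp
      ring
    have intw : Integrable (fun w => w * (hermiteReal k).eval (r * x + w)) (gaussianReal 0 v) :=
      (integrable_polynomial_gaussianReal v (X * (hermiteReal k).comp (C (r * x) + X))).congr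
        (ae_of_all _ fun w => by simp)
    simp_rw [e]
    rw [integral_sub (by exact ((int _).const_mul _).add intw) (int _),
      integral_add ((int _).const_mul _) intw, integral_const_mul, hx, hs, hv, hermiteReal_succ]
    simp only [eval_sub, eval_mul, eval_X]
    -- Integration by parts contributes `v = 1 - r ^ 2` times the mean of `H_k'` and the recurrence
    -- subtracts one such mean, leaving `-r ^ 2` times it.
    linear_combination (-r) * hd

end GaussianPolynomials

/-! ### Completeness of the Hermite polynomials in Gaussian `L²`. -/

section HermiteBasis

theorem memLp_exp_abs_mul_gaussianReal (s : ℝ) :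
    MemLp (fun x => Real.exp |s * x|) 2 (gaussianReal 0 1) := by
  rw [memLp_two_iff_integrable_sq (by fun_prop)]
  refine ((integrable_exp_mul_gaussianReal (μ := 0) (v := 1) (2 * s)).add
    (integrable_exp_mul_gaussianReal (μ := 0) (v := 1) (-(2 * s)))).mono'
    (by fun_prop) (ae_of_all _ fun x => ?_)
  rw [Real.norm_of_nonneg (by positivity), ← Real.exp_nat_mul, Pi.add_apply]
  rcases abs_cases (s * x) with ⟨h, -⟩ | ⟨h, -⟩
  · rw [h, show ((2 : ℕ) : ℝ) * (s * x) = 2 * s * x by push_cast; ring]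
    linarith [Real.exp_pos (-(2 * s) * x)]
  · rw [h, show ((2 : ℕ) : ℝ) * -(s * x) = -(2 * s) * x by push_cast; ring]
    linarith [Real.exp_pos (2 * s * x)]

/-- Expand the exponential under the integral: each term is a multiple of a vanishing moment, and
the series is dominated by `|f x| * exp |s * x|`, a product of two `L²` functions. -/
theorem integral_mul_cexp_eq_zero {f : ℝ → ℝ} (hf : MemLp f 2 (gaussianReal 0 1))
    (h : ∀ n : ℕ, ∫ x, f x * x ^ n ∂(gaussianReal 0 1) = 0) (s : ℝ) :
    ∫ x, (f x : ℂ) * Complex.exp (s * x * Complex.I) ∂(gaussianReal 0 1) = 0 := by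
  have hexp : ∀ z : ℂ, HasSum (fun n : ℕ => z ^ n / n !) (Complex.exp z) := fun z => by
    rw [Complex.exp_eq_exp_ℂ]
    exact NormedSpace.expSeries_div_hasSum_exp z
  have hexp' : ∀ a : ℝ, ∑' n : ℕ, a ^ n / n ! = Real.exp a := fun a => by
    rw [Real.exp_eq_exp_ℝ, NormedSpace.exp_eq_tsum_div]
  have hsum := hasSum_integral_of_dominated_convergence (μ := gaussianReal 0 1)
    (F := fun n x => (f x : ℂ) * ((s * x * Complex.I) ^ n / n !))
    (f := fun x => (f x : ℂ) * Complex.exp (s * x * Complex.I))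
    (fun n x => |f x| * (|s * x| ^ n / n !))
    (fun n => by
      have := hf.aestronglyMeasurable
      have h2 : AEStronglyMeasurable (fun x => (f x : ℂ)) (gaussianReal 0 1) :=
        Complex.continuous_ofReal.comp_aestronglyMeasurable this
      exact h2.mul (by fun_prop))
    (fun n => ae_of_all _ fun x => by simp [abs_mul])
    (ae_of_all _ fun x => (Real.summable_pow_div_factorial _).mul_left _)
    (by
      have : ∀ x, ∑' n : ℕ, |f x| * (|s * x| ^ n / n !) = |f x| * Real.exp |s * x| := fun x => by
        rw [tsum_mul_left, hexp']
      simp_rw [this]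
      exact hf.abs.integrable_mul (memLp_exp_abs_mul_gaussianReal s))
    (ae_of_all _ fun x => (hexp _).mul_left _)
  refine hsum.unique ?_
  convert hasSum_zero with n
  have : ∀ x : ℝ, (f x : ℂ) * ((s * x * Complex.I) ^ n / n !) =
      (s * Complex.I) ^ n / n ! * ((f x * x ^ n : ℝ) : ℂ) := fun x => by
    push_cast
    ring
  simp_rw [this]
  rw [integral_const_mul, integral_complex_ofReal, h n]
  simp

/-- Polynomials are complete in `L²` of the standard Gaussian measure. -/
theorem ae_eq_zero_of_integral_mul_pow_eq_zero {f : ℝ → ℝ} (hf : MemLp f 2 (gaussianReal 0 1))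
    (h : ∀ n : ℕ, ∫ x, f x * x ^ n ∂(gaussianReal 0 1) = 0) : f =ᵐ[gaussianReal 0 1] 0 := by
  have hfi : Integrable f (gaussianReal 0 1) := hf.integrable (by norm_num)
  have hfm : AEMeasurable f (gaussianReal 0 1) := hf.aestronglyMeasurable.aemeasurable
  have fin : ∀ g : ℝ → ℝ, Integrable g (gaussianReal 0 1) →
      IsFiniteMeasure ((gaussianReal 0 1).withDensity fun x => ENNReal.ofReal (g x)) :=
    fun g hg => isFiniteMeasure_withDensity_ofReal hg.2
  have hfn : AEMeasurable (fun x => -f x) (gaussianReal 0 1) := hfm.neg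
  have hint : ∀ g : ℝ → ℝ, Integrable g (gaussianReal 0 1) → ∀ s : ℝ,
      Integrable (fun x => (ENNReal.ofReal (g x)).toReal • Complex.exp (s * x * Complex.I))
        (gaussianReal 0 1) := fun g hg s => by
    refine hg.norm.mono' ?_ (ae_of_all _ fun x => ?_)
    · exact hg.1.aemeasurable.ennreal_ofReal.ennreal_toReal.aestronglyMeasurable.smul (by fun_prop)
    · rw [norm_smul, ← Complex.ofReal_mul, Complex.norm_exp_ofReal_mul_I, mul_one,
        ENNReal.toReal_ofReal', Real.norm_eq_abs, Real.norm_eq_abs, abs_of_nonneg (le_max_right _ _)]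
      exact max_le (le_abs_self _) (abs_nonneg _)
  have := fin f hfi
  have := fin (fun x => -f x) hfi.neg
  -- The positive and negative parts of `f` are densities of finite measures; their characteristic
  -- functions differ by the Fourier integral of `f`, which is zero, so the measures coincide.
  have heq : ((gaussianReal 0 1).withDensity fun x => ENNReal.ofReal (f x)) =
      (gaussianReal 0 1).withDensity fun x => ENNReal.ofReal (-f x) := by
    refine Measure.ext_of_charFun (funext fun s => ?_)
    rw [charFun_apply_real, charFun_apply_real,
      integral_withDensity_eq_integral_toReal_smul₀ hfm.ennreal_ofReal (by simp),
      integral_withDensity_eq_integral_toReal_smul₀ hfn.ennreal_ofReal (by simp),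
      ← sub_eq_zero, ← integral_sub, ← integral_mul_cexp_eq_zero hf h s]
    · refine integral_congr_ae (ae_of_all _ fun x => ?_)
      have hx : ((ENNReal.ofReal (f x)).toReal : ℂ) - (ENNReal.ofReal (-f x)).toReal = f x := by
        rw [← Complex.ofReal_sub, ENNReal.toReal_ofReal', ENNReal.toReal_ofReal']
        congr 1
        rcases le_total 0 (f x) with h | h
        · simp [h]
        · simp [h]
      simp only [Complex.real_smul]
      rw [← sub_mul, hx]
    · exact hint _ hfi s
    · exact hint _ hfi.neg s
  rw [withDensity_eq_iff hfm.ennreal_ofReal hfn.ennreal_ofReal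
    (by
      have := measure_ne_top ((gaussianReal 0 1).withDensity fun x => ENNReal.ofReal (f x)) Set.univ
      rwa [withDensity_apply _ .univ, setLIntegral_univ] at this)] at heq
  filter_upwards [heq] with x hx
  rcases le_total 0 (f x) with h | h
  · rw [ENNReal.ofReal_of_nonpos (neg_nonpos.2 h), ENNReal.ofReal_eq_zero] at hx
    exact le_antisymm hx h
  · rw [ENNReal.ofReal_of_nonpos h, eq_comm, ENNReal.ofReal_eq_zero] at hx
    exact le_antisymm h (by simpa using hx)

/-- Multiplication by `X` preserves the span, because `X H_k = H_{k+1} + H_k'` and `H_k'` is a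
multiple of `H_{k-1}`. -/
theorem X_pow_mem_span_hermiteReal (n : ℕ) :
    (X ^ n : ℝ[X]) ∈ Submodule.span ℝ (Set.range hermiteReal) := by
  induction n with
  | zero => exact Submodule.subset_span ⟨0, by simp [hermiteReal_zero]⟩
  | succ n ih =>
    rw [pow_succ']
    generalize (X ^ n : ℝ[X]) = p at ih
    induction ih using Submodule.span_induction with
    | mem p hp =>
      obtain ⟨k, rfl⟩ := hp
      have hX : X * hermiteReal k = hermiteReal (k + 1) + derivative (hermiteReal k) := by
        rw [hermiteReal_succ]
        ring
      rw [hX]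
      refine add_mem (Submodule.subset_span ⟨_, rfl⟩) ?_
      cases k with
      | zero => simp [hermiteReal_zero]
      | succ k =>
        rw [derivative_hermiteReal_succ, ← smul_eq_C_mul]
        exact Submodule.smul_mem _ _ (Submodule.subset_span ⟨_, rfl⟩)
    | zero => simp
    | add p q _ _ hp hq =>
      rw [mul_add]
      exact add_mem hp hq
    | smul a p _ hp =>
      rw [mul_smul_comm]
      exact Submodule.smul_mem _ _ hp

/-- The normalised Hermite polynomial as an element of `L²` of the standard Gaussian measure. -/
def hermiteLp (k : ℕ) : Lp ℝ 2 (gaussianReal 0 1) :=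
  (√(k ! : ℝ))⁻¹ • (memLp_polynomial_gaussianReal 1 (hermiteReal k)).toLp _

theorem inner_toLp {α : Type*} [MeasurableSpace α] {m : Measure α} {f g : α → ℝ} (hf : MemLp f 2 m)
    (hg : MemLp g 2 m) : inner ℝ (hf.toLp f) (hg.toLp g) = ∫ x, f x * g x ∂m := by
  rw [L2.inner_def]
  refine integral_congr_ae ?_
  filter_upwards [hf.coeFn_toLp, hg.coeFn_toLp] with x h1 h2
  rw [h1, h2]
  simp [mul_comm]

theorem inner_hermiteLp {f : ℝ → ℝ} (hf : MemLp f 2 (gaussianReal 0 1)) (k : ℕ) :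
    inner ℝ (hf.toLp f) (hermiteLp k) =
      (√(k ! : ℝ))⁻¹ * ∫ x, f x * (hermiteReal k).eval x ∂(gaussianReal 0 1) := by
  rw [hermiteLp, inner_smul_right, inner_toLp]

theorem orthonormal_hermiteLp : Orthonormal ℝ hermiteLp := by
  rw [orthonormal_iff_ite]
  intro i j
  rw [hermiteLp, inner_smul_left, inner_hermiteLp]
  have hpos : ∀ k : ℕ, (0 : ℝ) < k ! := fun k => by exact_mod_cast k.factorial_pos
  simp only [RCLike.conj_to_real]
  split_ifs with h
  · subst h
    have := integral_hermiteReal_mul_self i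
    simp only [eval_mul] at this
    rw [this, ← mul_assoc, ← mul_inv, Real.mul_self_sqrt (hpos i).le, inv_mul_cancel₀ (hpos i).ne']
  · rcases lt_or_gt_of_ne h with h | h
    · have := integral_hermiteReal_mul_of_lt h
      simp only [eval_mul, mul_comm (eval _ (hermiteReal j))] at this
      rw [this, mul_zero, mul_zero]
    · have := integral_hermiteReal_mul_of_lt h
      simp only [eval_mul] at this
      rw [this, mul_zero, mul_zero]

theorem orthogonal_span_hermiteLp :
    (Submodule.span ℝ (Set.range hermiteLp)).orthogonal = ⊥ := by
  rw [Submodule.eq_bot_iff]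
  intro f hf
  rw [Submodule.mem_orthogonal'] at hf
  have hfL := Lp.memLp f
  have hH : ∀ k, ∫ x, f x * (hermiteReal k).eval x ∂(gaussianReal 0 1) = 0 := fun k => by
    have h := hf _ (Submodule.subset_span ⟨k, rfl⟩)
    have e : hfL.toLp f = f := Lp.toLp_coeFn f hfL
    rw [← e, inner_hermiteLp] at h
    have hpos : (0 : ℝ) < k ! := by exact_mod_cast k.factorial_pos
    exact (mul_eq_zero.1 h).resolve_left (by positivity)
  have hP : ∀ p ∈ Submodule.span ℝ (Set.range hermiteReal),
      ∫ x, f x * p.eval x ∂(gaussianReal 0 1) = 0 := fun p hp => by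
    have int : ∀ q : ℝ[X], Integrable (fun x => f x * q.eval x) (gaussianReal 0 1) := fun q =>
      hfL.integrable_mul (memLp_polynomial_gaussianReal 1 q)
    induction hp using Submodule.span_induction with
    | mem p hp =>
      obtain ⟨k, rfl⟩ := hp
      exact hH k
    | zero => simp
    | add p q _ _ hp hq =>
      simp only [eval_add, mul_add]
      rw [integral_add (int p) (int q), hp, hq, add_zero]
    | smul a p _ hp =>
      simp only [eval_smul, smul_eq_mul, mul_left_comm _ a]
      rw [integral_const_mul, hp, mul_zero]
  have h0 := ae_eq_zero_of_integral_mul_pow_eq_zero hfL fun n => by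
    simpa using hP _ (X_pow_mem_span_hermiteReal n)
  exact (Lp.eq_zero_iff_ae_eq_zero).2 h0

/-- The Hermite basis of `L²` of the standard Gaussian measure. -/
def hermiteBasis : HilbertBasis ℕ ℝ (Lp ℝ 2 (gaussianReal 0 1)) :=
  HilbertBasis.mkOfOrthogonalEqBot orthonormal_hermiteLp orthogonal_span_hermiteLp

theorem hermiteBasis_apply (k : ℕ) : hermiteBasis k = hermiteLp k := by
  simp [hermiteBasis]

end HermiteBasis

/-! ### Mehler's expansion for a standard Gaussian pair. -/

section Mehler

variable {Ω : Type*} [MeasurableSpace Ω] {P : Measure Ω} {U V : Ω → ℝ}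

theorem map_eq_gaussianReal_of_standard (hU : HasGaussianLaw U P) (mU : P[U] = 0)
    (vU : Var[U; P] = 1) : P.map U = gaussianReal 0 1 := by
  rw [hU.map_eq_gaussianReal, mU, vU, Real.toNNReal_one]

/-- A standard bivariate Gaussian vector with correlation `r` splits into a standard Gaussian variable
and an independent residual of variance `1 - r ^ 2`. -/
theorem exists_map_residual_eq_prod (hUV : HasGaussianLaw (fun ω => (U ω, V ω)) P)
    (mU : P[U] = 0) (mV : P[V] = 0) (vU : Var[U; P] = 1) (vV : Var[V; P] = 1) :
    ∃ v : ℝ≥0, (v : ℝ) = 1 - cov[U, V; P] ^ 2 ∧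
      P.map (fun ω => (U ω, V ω - cov[U, V; P] * U ω)) =
        (gaussianReal 0 1).prod (gaussianReal 0 v) := by
  have := hUV.isProbabilityMeasure
  set r := cov[U, V; P] with hr
  have hUW : HasGaussianLaw (fun ω => (U ω, V ω - r * U ω)) P :=
    hUV.map_fun ((ContinuousLinearMap.fst ℝ ℝ ℝ).prod
      (ContinuousLinearMap.snd ℝ ℝ ℝ - r • ContinuousLinearMap.fst ℝ ℝ ℝ))
  have hU2 := hUV.fst.memLp_two
  have hV2 := hUV.snd.memLp_two
  have hrU : MemLp (fun ω => r * U ω) 2 P := hU2.const_mul r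
  have hcov : cov[U, fun ω => V ω - r * U ω; P] = 0 := by
    rw [covariance_fun_sub_right hU2 hV2 hrU, covariance_const_mul_right,
      covariance_self hU2.aemeasurable, vU]
    simp [hr]
  have hW0 : P[fun ω => V ω - r * U ω] = 0 := by
    rw [integral_sub (hV2.integrable (by norm_num)) (hrU.integrable (by norm_num)),
      integral_const_mul, mU, mV]
    simp
  have hWv : Var[fun ω => V ω - r * U ω; P] = 1 - r ^ 2 := by
    rw [variance_fun_sub hV2 hrU, variance_const_mul, covariance_const_mul_right, covariance_comm,
      vU, vV, ← hr]
    ring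
  refine ⟨Var[fun ω => V ω - r * U ω; P].toNNReal, ?_, ?_⟩
  · rw [Real.coe_toNNReal _ (variance_nonneg _ _), hWv]
  · rw [(indepFun_iff_map_prod_eq_prod_map_map hUW.fst.aemeasurable hUW.snd.aemeasurable).1
      (hUW.indepFun_of_covariance_eq_zero hcov), map_eq_gaussianReal_of_standard hUV.fst mU vU,
      hUW.snd.map_eq_gaussianReal, hW0]

/-- Write `V = r U + W` with `W` independent of `U`; integrating `W` out first replaces `H_k(V)` by
`r ^ k H_k(U)`. -/
theorem integral_comp_mul_hermiteReal (hUV : HasGaussianLaw (fun ω => (U ω, V ω)) P)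
    (mU : P[U] = 0) (mV : P[V] = 0) (vU : Var[U; P] = 1) (vV : Var[V; P] = 1)
    {f : ℝ → ℝ} (hfm : Measurable f) (hf : MemLp f 2 (gaussianReal 0 1)) (k : ℕ) :
    ∫ ω, f (U ω) * (hermiteReal k).eval (V ω) ∂P =
      cov[U, V; P] ^ k * ∫ x, f x * (hermiteReal k).eval x ∂(gaussianReal 0 1) := by
  obtain ⟨v, hv, hmap⟩ := exists_map_residual_eq_prod hUV mU mV vU vV
  set r := cov[U, V; P] with hr
  have hUm := hUV.fst.aemeasurable
  have hVm := hUV.snd.aemeasurable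
  have hWm : AEMeasurable (fun ω => (U ω, V ω - r * U ω)) P :=
    hUm.prodMk (hVm.sub (hUm.const_mul r))
  have hFm : Measurable fun z : ℝ × ℝ => f z.1 * (hermiteReal k).eval (r * z.1 + z.2) :=
    (hfm.comp measurable_fst).mul
      ((hermiteReal k).continuous.measurable.comp (by fun_prop))
  have hmpU : MemLp (fun ω => f (U ω)) 2 P := by
    rw [← map_eq_gaussianReal_of_standard hUV.fst mU vU] at hf
    exact hf.comp_of_map hUm
  have hmpV : MemLp (fun ω => (hermiteReal k).eval (V ω)) 2 P := by
    have h := memLp_polynomial_gaussianReal 1 (hermiteReal k)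
    rw [← map_eq_gaussianReal_of_standard hUV.snd mV vV] at h
    exact h.comp_of_map hVm
  have hint : Integrable (fun z : ℝ × ℝ => f z.1 * (hermiteReal k).eval (r * z.1 + z.2))
      ((gaussianReal 0 1).prod (gaussianReal 0 v)) := by
    rw [← hmap, integrable_map_measure hFm.aestronglyMeasurable hWm]
    refine (hmpU.integrable_mul hmpV).congr (ae_of_all _ fun ω => ?_)
    simp
  have h1 : ∫ ω, f (U ω) * (hermiteReal k).eval (V ω) ∂P =
      ∫ z, f z.1 * (hermiteReal k).eval (r * z.1 + z.2)
        ∂((gaussianReal 0 1).prod (gaussianReal 0 v)) := by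
    rw [← hmap, integral_map hWm hFm.aestronglyMeasurable]
    simp
  rw [h1, integral_prod _ hint, ← integral_const_mul]
  refine integral_congr_ae (ae_of_all _ fun x => ?_)
  simp only
  rw [integral_const_mul, integral_hermiteReal_add_gaussianReal hv]
  ring

/-- Mehler's expansion of `E[f(U) f(V)]` for a standard bivariate Gaussian vector `(U, V)`. -/
theorem hasSum_integral_comp_mul_comp (hUV : HasGaussianLaw (fun ω => (U ω, V ω)) P)
    (mU : P[U] = 0) (mV : P[V] = 0) (vU : Var[U; P] = 1) (vV : Var[V; P] = 1)
    (hUm : Measurable U) (hVm : Measurable V)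
    {f : ℝ → ℝ} (hfm : Measurable f) (hf : MemLp f 2 (gaussianReal 0 1)) :
    HasSum (fun k : ℕ => (∫ x, f x * (hermiteReal k).eval x ∂(gaussianReal 0 1)) ^ 2 / k ! *
      cov[U, V; P] ^ k) (∫ ω, f (U ω) * f (V ω) ∂P) := by
  have pU : MeasurePreserving U P (gaussianReal 0 1) :=
    ⟨hUm, map_eq_gaussianReal_of_standard hUV.fst mU vU⟩
  have pV : MeasurePreserving V P (gaussianReal 0 1) :=
    ⟨hVm, map_eq_gaussianReal_of_standard hUV.snd mV vV⟩
  let A : Lp ℝ 2 P := (hf.comp_measurePreserving pU).toLp _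
  let B : Lp ℝ 2 (gaussianReal 0 1) →L[ℝ] Lp ℝ 2 P :=
    (Lp.compMeasurePreservingₗᵢ ℝ V pV).toContinuousLinearMap
  have hB : ∀ {g : ℝ → ℝ} (hg : MemLp g 2 (gaussianReal 0 1)),
      B (hg.toLp g) = (hg.comp_measurePreserving pV).toLp _ := fun hg =>
    Lp.toLp_compMeasurePreserving hg pV
  -- Only the factor `f(V)` is expanded. Composition with `V` is an isometry `B` into `L²(P)`, so
  -- pairing with `A = f(U)` passes through the series.
  have h := (hermiteBasis.hasSum_repr (hf.toLp f)).mapL ((innerSL ℝ A).comp B)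
  have hval : ((innerSL ℝ A).comp B) (hf.toLp f) = ∫ ω, f (U ω) * f (V ω) ∂P := by
    rw [ContinuousLinearMap.comp_apply, innerSL_apply_apply, hB, inner_toLp]
    rfl
  rw [hval] at h
  refine h.congr_fun ?_
  intro k
  have hpos : (0 : ℝ) < k ! := by exact_mod_cast k.factorial_pos
  rw [map_smul, HilbertBasis.repr_apply_apply, hermiteBasis_apply, real_inner_comm,
    inner_hermiteLp, hermiteLp, map_smul, ContinuousLinearMap.comp_apply, hB, innerSL_apply_apply,
    inner_toLp]
  simp only [Function.comp_apply]
  rw [integral_comp_mul_hermiteReal hUV mU mV vU vV hfm hf k, smul_eq_mul, smul_eq_mul]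
  -- One factor comes from the coefficient of `f`, the other from the normalised basis vector.
  have hs : (√(k ! : ℝ))⁻¹ * (√(k ! : ℝ))⁻¹ = (k ! : ℝ)⁻¹ := by
    rw [← mul_inv, Real.mul_self_sqrt hpos.le]
  rw [div_eq_mul_inv, ← hs]
  ring

theorem hasSum_covariance_comp (hUV : HasGaussianLaw (fun ω => (U ω, V ω)) P)
    (mU : P[U] = 0) (mV : P[V] = 0) (vU : Var[U; P] = 1) (vV : Var[V; P] = 1)
    (hUm : Measurable U) (hVm : Measurable V)
    {f : ℝ → ℝ} (hfm : Measurable f) (hf : MemLp f 2 (gaussianReal 0 1)) :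
    HasSum (fun k : ℕ =>
        (∫ x, f x * (hermiteReal (k + 1)).eval x ∂(gaussianReal 0 1)) ^ 2 / (k + 1)! *
          cov[U, V; P] ^ (k + 1))
      (∫ ω, f (U ω) * f (V ω) ∂P - (∫ ω, f (U ω) ∂P) * ∫ ω, f (V ω) ∂P) := by
  -- Since `H_0 = 1`, the term `k = 0` is the product of the means; removing it shifts the index by
  -- one.
  have h := (hasSum_nat_add_iff' 1).2
    (hasSum_integral_comp_mul_comp hUV mU mV vU vV hUm hVm hfm hf)
  have eU : ∫ ω, f (U ω) ∂P = ∫ x, f x ∂(gaussianReal 0 1) := by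
    rw [← map_eq_gaussianReal_of_standard hUV.fst mU vU,
      integral_map hUm.aemeasurable hfm.aestronglyMeasurable]
  have eV : ∫ ω, f (V ω) ∂P = ∫ x, f x ∂(gaussianReal 0 1) := by
    rw [← map_eq_gaussianReal_of_standard hUV.snd mV vV,
      integral_map hVm.aemeasurable hfm.aestronglyMeasurable]
  rw [eU, eV, ← sq]
  simpa [hermiteReal_zero] using h

end Mehler

/-! ### Averaging the family `g u` over `μ`. -/

section Volatility

variable {Ω : Type*} [MeasurableSpace Ω] {P : Measure Ω} {U V : Ω → ℝ}
  {g : ℝ → ℝ → ℝ} {μ : Measure ℝ}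

/-- Averaging the covariances of a bounded family of functions gives the covariance of the average. -/
theorem integral_covariance_comp [IsProbabilityMeasure P] [IsFiniteMeasure μ]
    (hU : Measurable U) (hV : Measurable V)
    (hg : Measurable (Function.uncurry g)) (hb : ∀ u y, |g u y| ≤ 1) :
    ∫ p : ℝ × ℝ, cov[fun ω => g p.1 (U ω), fun ω => g p.2 (V ω); P] ∂(μ.prod μ) =
      ∫ ω, (∫ u, g u (U ω) ∂μ) * (∫ u, g u (V ω) ∂μ) ∂P -
        (∫ ω, ∫ u, g u (U ω) ∂μ ∂P) * ∫ ω, ∫ u, g u (V ω) ∂μ ∂P := by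
  have hbd : ∀ {α : Type _} [MeasurableSpace α] {m : Measure α} [IsFiniteMeasure m] {F : α → ℝ},
      Measurable F → (∀ a, |F a| ≤ 1) → ∀ q, MemLp F q m := fun hF h q =>
    MemLp.of_bound hF.aestronglyMeasurable 1 (ae_of_all _ h)
  have hgU : ∀ {W : Ω → ℝ}, Measurable W → ∀ u, Measurable fun ω => g u (W ω) := fun hW u =>
    hg.comp (measurable_const.prodMk hW)
  have hcov : ∀ p : ℝ × ℝ, cov[fun ω => g p.1 (U ω), fun ω => g p.2 (V ω); P] =
      ∫ ω, g p.1 (U ω) * g p.2 (V ω) ∂P - (∫ ω, g p.1 (U ω) ∂P) * ∫ ω, g p.2 (V ω) ∂P := fun p => by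
    rw [covariance_eq_sub (hbd (hgU hU _) (fun _ => hb _ _) 2) (hbd (hgU hV _) (fun _ => hb _ _) 2)]
    rfl
  have hm3 : Measurable fun z : (ℝ × ℝ) × Ω => g z.1.1 (U z.2) * g z.1.2 (V z.2) :=
    (hg.comp (measurable_fst.fst.prodMk (hU.comp measurable_snd))).mul
      (hg.comp (measurable_fst.snd.prodMk (hV.comp measurable_snd)))
  have hi3 : Integrable (fun z : (ℝ × ℝ) × Ω => g z.1.1 (U z.2) * g z.1.2 (V z.2))
      ((μ.prod μ).prod P) :=
    Integrable.of_bound hm3.aestronglyMeasurable 1 (ae_of_all _ fun z => by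
      rw [Real.norm_eq_abs, abs_mul]
      exact mul_le_one₀ (hb _ _) (abs_nonneg _) (hb _ _))
  have hm2 : ∀ {W : Ω → ℝ}, Measurable W → Measurable fun z : ℝ × Ω => g z.1 (W z.2) := fun hW =>
    hg.comp (measurable_fst.prodMk (hW.comp measurable_snd))
  have hi2 : ∀ {W : Ω → ℝ}, Measurable W → Integrable (fun z : ℝ × Ω => g z.1 (W z.2)) (μ.prod P) :=
    fun hW => Integrable.of_bound (hm2 hW).aestronglyMeasurable 1 (ae_of_all _ fun z => hb _ _)
  simp_rw [hcov]
  rw [integral_sub hi3.integral_prod_left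
      ((hi2 hU).integral_prod_left.mul_prod (hi2 hV).integral_prod_left),
    integral_prod_mul (fun u => ∫ ω, g u (U ω) ∂P) (fun u => ∫ ω, g u (V ω) ∂P),
    integral_integral_swap (f := fun u ω => g u (U ω)) (hi2 hU),
    integral_integral_swap (f := fun u ω => g u (V ω)) (hi2 hV),
    integral_integral_swap (f := fun (p : ℝ × ℝ) ω => g p.1 (U ω) * g p.2 (V ω)) hi3]
  congr 1
  exact integral_congr_ae
    (ae_of_all _ fun ω => integral_prod_mul (fun u => g u (U ω)) fun u => g u (V ω))

theorem measurable_integral_family [IsFiniteMeasure μ] (hg : Measurable (Function.uncurry g)) :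
    Measurable fun y => ∫ u, g u y ∂μ :=
  hg.stronglyMeasurable.integral_prod_left.measurable

theorem memLp_integral_family [IsFiniteMeasure μ] (hg : Measurable (Function.uncurry g))
    (hb : ∀ u y, |g u y| ≤ 1) : MemLp (fun y => ∫ u, g u y ∂μ) 2 (gaussianReal 0 1) :=
  MemLp.of_bound (measurable_integral_family hg).aestronglyMeasurable (1 * μ.real Set.univ)
    (ae_of_all _ fun y => norm_integral_le_of_norm_le_const (ae_of_all _ fun u => hb u y))

theorem integral_innerPhi_family [IsFiniteMeasure μ] (hg : Measurable (Function.uncurry g))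
    (hb : ∀ u y, |g u y| ≤ 1) (k : ℕ) :
    ∫ u, innerPhi (g u) (hermiteFun k) ∂μ =
      ∫ y, (∫ u, g u y ∂μ) * (hermiteReal k).eval y ∂(gaussianReal 0 1) := by
  have hphi : ∀ u, innerPhi (g u) (hermiteFun k) =
      ∫ y, g u y * (hermiteReal k).eval y ∂(gaussianReal 0 1) := fun u => by
    rw [integral_gaussianReal_eq_integral_smul one_ne_zero, innerPhi]
    simp only [hermiteFun_eq_eval, smul_eq_mul, mul_comm (gaussianPDFReal 0 1 _)]
  have hint : Integrable (fun z : ℝ × ℝ => g z.1 z.2 * (hermiteReal k).eval z.2)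
      (μ.prod (gaussianReal 0 1)) :=
    ((integrable_polynomial_gaussianReal 1 (hermiteReal k)).comp_snd μ).bdd_mul
      (c := 1) hg.aestronglyMeasurable (ae_of_all _ fun z => hb _ _)
  simp_rw [hphi]
  rw [integral_integral_swap hint]
  simp_rw [integral_mul_const]

theorem measurable_tail [IsFiniteMeasure P] (ζ : Ω → ℝ) : Measurable (tail P ζ) := by
  have : Antitone (tail P ζ) := fun a b hab =>
    sub_le_sub_left (measureReal_mono fun ω (hω : ζ ω ≤ a) => hω.trans hab) 1
  exact this.measurable

theorem abs_tail_le_one [IsProbabilityMeasure P] (ζ : Ω → ℝ) (x : ℝ) : |tail P ζ x| ≤ 1 := by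
  have h1 : P.real {ω | ζ ω ≤ x} ≤ 1 := measureReal_le_one
  have h0 : 0 ≤ P.real {ω | ζ ω ≤ x} := measureReal_nonneg
  rw [tail, abs_le]
  constructor <;> linarith

theorem extIntegral_of_nonneg {α : Type*} [MeasurableSpace α] {m : Measure α} {f : α → ℝ}
    (hf : ∀ t, 0 ≤ f t) :
    extIntegral m f = ((∫⁻ t, ENNReal.ofReal (f t) ∂m : ℝ≥0∞) : EReal) := by
  have h : ∀ t, ENNReal.ofReal (-f t) = 0 := fun t => ENNReal.ofReal_of_nonpos (neg_nonpos.2 (hf t))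
  simp [extIntegral, h]

end Volatility

end RandVol

end

/-! ### Integration of the expansion over `T`. -/

theorem mainTheorem6 {d : ℕ} (T : Set (RandVol.Idx d)) (hT : NullMeasurableSet T volume)
    (h0 : 0 ∈ T) {Ω : Type*} [MeasurableSpace Ω] (P : Measure Ω) [IsProbabilityMeasure P]
    (G : ℝ → ℝ) (Y Z X : T → Ω → ℝ) (hX : RandVol.IsRandomVolatility h0 P G Y Z X)
    (hGauss : IsGaussianProcess Y P) (hmean : ∀ t, P[Y t] = 0) (hvar : ∀ t, Var[Y t; P] = 1)
    (hρm : AEMeasurable (RandVol.covFun h0 P Y) (RandVol.indexMeasure T))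
    (hρ0 : ∀ t, 0 ≤ RandVol.covFun h0 P Y t)
    (hρ : RandVol.CondRho T (RandVol.covFun h0 P Y))
    (μ : Measure ℝ) [IsFiniteMeasure μ] :
    RandVol.D h0 P μ (fun t ω => G (Y t ω)) (Z ⟨0, h0⟩) =
      ((∑' k : ℕ,
        ENNReal.ofReal
          ((∫ u, RandVol.innerPhi (fun y => RandVol.tail P (Z ⟨0, h0⟩) (u / G y))
              (RandVol.hermiteFun (k + 1)) ∂μ) ^ 2 / ((k + 1).factorial : ℝ)) *
          ∫⁻ t, ENNReal.ofReal (RandVol.covFun h0 P Y t ^ (k + 1)) ∂(RandVol.indexMeasure T) :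
        ℝ≥0∞) : EReal) := by
  let g : ℝ → ℝ → ℝ := fun u y => RandVol.tail P (Z ⟨0, h0⟩) (u / G y)
  have hg : Measurable (Function.uncurry g) :=
    (RandVol.measurable_tail _).comp (measurable_fst.div (hX.measurable_G.comp measurable_snd))
  have hb : ∀ u y, |g u y| ≤ 1 := fun u y => RandVol.abs_tail_le_one _ _
  have hsum : ∀ t : T, HasSum (fun k : ℕ =>
      (∫ u, RandVol.innerPhi (g u) (RandVol.hermiteFun (k + 1)) ∂μ) ^ 2 / ((k + 1).factorial : ℝ) *
        RandVol.covFun h0 P Y t ^ (k + 1))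
      (∫ p : ℝ × ℝ, cov[fun ω => g p.1 (Y ⟨0, h0⟩ ω), fun ω => g p.2 (Y t ω); P] ∂(μ.prod μ)) := by
    intro t
    rw [RandVol.integral_covariance_comp (hX.measurable_Y _) (hX.measurable_Y t) hg hb]
    simp_rw [RandVol.integral_innerPhi_family hg hb]
    exact RandVol.hasSum_covariance_comp hGauss.hasGaussianLaw_prodMk (hmean _) (hmean _) (hvar _)
      (hvar _) (hX.measurable_Y _) (hX.measurable_Y _) (RandVol.measurable_integral_family hg)
      (RandVol.memLp_integral_family hg hb)
  have hnn : ∀ (k : ℕ) (t : T), 0 ≤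
      (∫ u, RandVol.innerPhi (g u) (RandVol.hermiteFun (k + 1)) ∂μ) ^ 2 / ((k + 1).factorial : ℝ) *
        RandVol.covFun h0 P Y t ^ (k + 1) := fun k t =>
    mul_nonneg (by positivity) (pow_nonneg (hρ0 t) _)
  -- A sum of nonnegative terms is nonnegative, so the undefined case `∞ - ∞` cannot occur.
  have hD := RandVol.extIntegral_of_nonneg (m := RandVol.indexMeasure T)
    fun t => (hsum t).nonneg fun k => hnn k t
  refine hD.trans ?_
  congr 1
  simp_rw [← (hsum _).tsum_eq]
  -- Tonelli for a series holds over any measure, so counting and Lebesgue measure need no separate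
  -- treatment.
  rw [lintegral_congr fun t => ENNReal.ofReal_tsum_of_nonneg (fun k => hnn k t) (hsum t).summable,
    lintegral_tsum fun k => ((hρm.pow_const _).const_mul _).ennreal_ofReal]
  refine tsum_congr fun k => ?_
  -- In `ℝ≥0∞` one has `0 * ∞ = 0`, which is the convention for vanishing coefficients.
  rw [← lintegral_const_mul' _ _ ENNReal.ofReal_ne_top]
  refine lintegral_congr fun t => ?_
  rw [ENNReal.ofReal_mul (by positivity)]
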